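/- Let $(\cdot,\cdot)$ and $\|\cdot\|$ be the Euclidean inner product and norm of $\mathbb R^n$, let $B_R(c)$ be the closed ball of radius $R$ centred at $c$, and let $h$ be the Hausdorff distance. Let $\varepsilon\in(0,1)$, $r>0$, $d>0$, and put $R=\max\{r^2/\varepsilon,\;r+1\}$. For a metric space $(T,\varrho)$ call a set-valued map $F:T\to 2^{\mathbb R^n}\setminus\{\emptyset\}$ *$(r,d)$-admissible* if it is continuous (i.e. for every $t_0\in T$ and $\eta>0$ there is $\delta>0$ such that $\varrho(t,t_0)<\delta$ implies $F(t)\subset F(t_0)+B_\eta(0)$ and $F(t_0)\subset F(t)+B_\eta(0)$), its images are compact and convex, for every $t\in T$ there is $a(t)\in\mathbb R^n$ with $F(t)\subset B_r(a(t))$, and $\operatorname{diam}F(t)\ge d$ for all $t\in T$. For such $F$ let $F_\varepsilon(t)$ be the $R$-strongly convex hull of $F(t)$, that is, the intersection of all closed balls of radius $R$ that contain $F(t)$. (i) There is a constant $C$ depending only on $\varepsilon,r,d$ such that for every $n$, every metric space $T$ and every $(r,d)$-admissible $F:T\to2^{\mathbb R^n}\setminus\{\emptyset\}$ the following holds. For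 all $t\in T$ the set $F_\varepsilon(t)$ is compact and convex, $F(t)\subset F_\varepsilon(t)$ and $h(F(t),F_\varepsilon(t))\le\varepsilon$. For all $t\in T$ and all $p\in\mathbb R^n$ with $\|p\|=1$ the problem $\max\{(p,x)\mid x\in F_\varepsilon(t)\}$ has a unique solution $f_\varepsilon(t,p)$, and for all $t_1,t_2\in T$ and $\|p\|=1$ $$\|f_\varepsilon(t_1,p)-f_\varepsilon(t_2,p)\|\le C\max\Big\{\sqrt{h(F(t_1),F(t_2))},\;h(F(t_1),F(t_2))\Big\}.$$ Thus $f_\varepsilon(\cdot,p)$ is Hölder continuous with power $\tfrac12$ with respect to $h(F(t_1),F(t_2))$, with constant $C$ as long as $h(F(t_1),F(t_2))\le1$, and with constant $C\max\{1,\sqrt M\}$ as long as $h(F(t_1),F(t_2))\le M$. (ii) The power $\tfrac12$ is the best possible for this approximation: if $n\ge2$ and $d<2r$, there are a metric space $T$ and an $(r,d)$-admissible map $F:T\to2^{\mathbb R^n}\setminus\{\emptyset\}$ such that for every $\alpha>\tfrac12$, every $C\in\mathbb R$ and every $\delta>0$ there are $t_1,t_2\in T$ and $p\in\mathbb R^n$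 with $\|p\|=1$ for which $h(F(t_1),F(t_2))<\delta$ and $$\|f_\varepsilon(t_1,p)-f_\varepsilon(t_2,p)\|>C\,h(F(t_1),F(t_2))^{\alpha}.$$ -/

import Mathlib

open scoped Pointwise

/-- Upper semicontinuity of a set-valued map at `t₀`, in the `ε`-`δ` sense. -/
def UpperSemicontAt {T E : Type*} [MetricSpace T] [NormedAddCommGroup E]
    (F : T → Set E) (t₀ : T) : Prop :=
  ∀ η : ℝ, 0 < η → ∃ δ : ℝ, 0 < δ ∧ ∀ t : T, dist t t₀ < δ →
    F t ⊆ F t₀ + Metric.closedBall (0 : E) η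

/-- Lower semicontinuity of a set-valued map at `t₀`, in the `ε`-`δ` sense. -/
def LowerSemicontAt {T E : Type*} [MetricSpace T] [NormedAddCommGroup E]
    (F : T → Set E) (t₀ : T) : Prop :=
  ∀ η : ℝ, 0 < η → ∃ δ : ℝ, 0 < δ ∧ ∀ t : T, dist t t₀ < δ →
    F t₀ ⊆ F t + Metric.closedBall (0 : E) η

/-- A set-valued map is continuous if it is upper and lower semicontinuous at every point. -/
def SetValuedContinuous {T E : Type*} [MetricSpace T] [NormedAddCommGroup E]
    (F : T → Set E) : Prop :=
  ∀ t₀ : T, UpperSemicontAt F t₀ ∧ LowerSemicontAt F t₀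

/-- Continuous set-valued maps with nonempty convex compact images, each contained in some closed
ball of radius `r` and each of diameter at least `d`. -/
structure IsAdmissible {n : ℕ} {T : Type*} [MetricSpace T] (r d : ℝ)
    (F : T → Set (EuclideanSpace ℝ (Fin n))) : Prop where
  continuous : SetValuedContinuous F
  nonempty : ∀ t, (F t).Nonempty
  compact : ∀ t, IsCompact (F t)
  convex : ∀ t, Convex ℝ (F t)
  subset_ball : ∀ t, ∃ a, F t ⊆ Metric.closedBall a r
  le_diam : ∀ t, d ≤ Metric.diam (F t)

/-- The solution set of the problem `max {(p, x) | x ∈ A}`. -/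
def argmaxSet {n : ℕ} (p : EuclideanSpace ℝ (Fin n)) (A : Set (EuclideanSpace ℝ (Fin n))) :
    Set (EuclideanSpace ℝ (Fin n)) :=
  {x | x ∈ A ∧ ∀ y ∈ A, inner ℝ p y ≤ inner ℝ p x}

/-- The `R`-strongly convex hull of `A`: the intersection of all closed balls of radius `R`
that contain `A`. -/
def stronglyConvexHull {n : ℕ} (R : ℝ) (A : Set (EuclideanSpace ℝ (Fin n))) :
    Set (EuclideanSpace ℝ (Fin n)) :=
  {x | ∀ c, A ⊆ Metric.closedBall c R → x ∈ Metric.closedBall c R}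

/-- The approximation `F_ε` of a map `F` whose images lie in balls of radius `r`: the strongly
convex hull of each image, with radius `max (r ^ 2 / ε) (r + 1)`. -/
noncomputable def strongApprox {n : ℕ} {T : Type*} (ε r : ℝ)
    (F : T → Set (EuclideanSpace ℝ (Fin n))) : T → Set (EuclideanSpace ℝ (Fin n)) :=
  fun t => stronglyConvexHull (max (r ^ 2 / ε) (r + 1)) (F t)

/-!
Put `R = max (r² / ε) (r + 1)`. A point `x` at positive distance from a convex set `A` inside an
`r`-ball is separated from `A` by a hyperplane at the same distance from `x`, and the part of the
`r`-ball on the side of `A` lies in an `R`-ball which reaches at most the sagitta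
`R - √(R² - r²) ≤ r² / R ≤ ε` beyond the hyperplane; hence the strongly convex hull stays within
`ε` of `A`.

A point `x` of the hull maximizing `⟪p, ·⟫` makes the hull lie in the `R`-ball centred at
`x - R p`. If `B` lies in the `h`-neighbourhood of `A`, moving the centre of an `R`-ball around `A`
towards the centre of the `r`-ball leaves room for `B`, so the hull of `B` lies in the original
`R`-ball enlarged by `O(h)`. Applied to both support points `x` and `y`, the parallelogram law for
`R p` and `x - y` turns this into `‖x - y‖² = O(h + h²)`.

For sharpness, let a point move out of a ball of radius `ρ` to height `u` above its surface. For
the direction `p` in which the `R`-ball touching this point contains the `ρ`-ball with internal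
tangency, the support point jumps from `ρ p` to the moving point, at a distance of order `√u`.
-/

open Metric

section Euclidean

variable {E : Type*} [NormedAddCommGroup E] [InnerProductSpace ℝ E] {a c e e' p v x y z : E}
  {R k r s t ρ : ℝ}

theorem real_inner_le_add_of_mem_closedBall (hp : ‖p‖ = 1) (hx : x ∈ closedBall c R) :
    inner ℝ p x ≤ inner ℝ p c + R := by
  rw [← sub_le_iff_le_add', ← inner_sub_right]
  calc inner ℝ p (x - c) ≤ ‖p‖ * ‖x - c‖ := real_inner_le_norm _ _
    _ ≤ R := by simpa only [hp, one_mul] using mem_closedBall_iff_norm.1 hx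

theorem norm_add_smul_sub_sub_sq :
    ‖x + t • (z - x) - c‖ ^ 2
      = (1 - t) * ‖x - c‖ ^ 2 + t * ‖z - c‖ ^ 2 - t * (1 - t) * ‖z - x‖ ^ 2 := by
  have hx : x + t • (z - x) - c = (x - c) + t • (z - x) := by abel
  have hz : z - c = (x - c) + (z - x) := by abel
  rw [hx, hz, norm_add_sq_real, norm_add_sq_real, inner_smul_right, norm_smul, Real.norm_eq_abs,
    mul_pow, sq_abs]
  ring

theorem add_smul_sub_add_smul_mem_closedBall (hR : 0 < R) (hx : x ∈ closedBall c R)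
    (hz : z ∈ closedBall c R) (hp : ‖p‖ ≤ 1) (ht₀ : 0 ≤ t) (ht₁ : t ≤ 1) :
    x + t • (z - x) + (t * (1 - t) * ‖z - x‖ ^ 2 / (2 * R)) • p ∈ closedBall c R := by
  rw [mem_closedBall_iff_norm] at hx hz ⊢
  have : 0 ≤ 1 - t := sub_nonneg.2 ht₁
  set q := t * (1 - t) * ‖z - x‖ ^ 2
  have hq : 0 ≤ q / (2 * R) := by positivity
  have hsq : ‖x + t • (z - x) - c‖ ^ 2 ≤ R ^ 2 - q := by
    rw [norm_add_smul_sub_sub_sq]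
    calc (1 - t) * ‖x - c‖ ^ 2 + t * ‖z - c‖ ^ 2 - q
        ≤ (1 - t) * R ^ 2 + t * R ^ 2 - q := by gcongr
      _ = R ^ 2 - q := by ring
  have hqR : q / (2 * R) ≤ R := by
    rw [div_le_iff₀ (by positivity)]
    nlinarith [sq_nonneg ‖x + t • (z - x) - c‖]
  have hle : ‖x + t • (z - x) - c‖ ≤ R - q / (2 * R) := by
    rw [← sq_le_sq₀ (norm_nonneg _) (sub_nonneg.2 hqR)]
    calc ‖x + t • (z - x) - c‖ ^ 2 ≤ R ^ 2 - q := hsq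
      _ ≤ R ^ 2 - q + (q / (2 * R)) ^ 2 := le_add_of_nonneg_right (sq_nonneg _)
      _ = (R - q / (2 * R)) ^ 2 := by field
  calc ‖x + t • (z - x) + (q / (2 * R)) • p - c‖
      = ‖(x + t • (z - x) - c) + (q / (2 * R)) • p‖ := by congr 1; abel
    _ ≤ ‖x + t • (z - x) - c‖ + q / (2 * R) * ‖p‖ := by
        simpa only [norm_smul, Real.norm_of_nonneg hq] using
          norm_add_le (x + t • (z - x) - c) ((q / (2 * R)) • p)
    _ ≤ R - q / (2 * R) + q / (2 * R) * 1 := by gcongr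
    _ = R := by ring

theorem norm_sub_sq_le_of_mem_closedBall_sub_smul (hp : ‖p‖ = 1)
    (hx : x ∈ closedBall (y - R • p) (R + k)) (hy : y ∈ closedBall (x - R • p) (R + k)) :
    ‖x - y‖ ^ 2 ≤ 2 * R * k + k ^ 2 := by
  rw [mem_closedBall_iff_norm] at hx hy
  have hx_sq := pow_le_pow_left₀ (norm_nonneg _) hx 2
  have hy_sq := pow_le_pow_left₀ (norm_nonneg _) hy 2
  have parallelogram := parallelogram_law_with_norm ℝ (R • p) (x - y)
  rw [show R • p + (x - y) = x - (y - R • p) by abel,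
    show R • p - (x - y) = y - (x - R • p) by abel, norm_smul, hp, mul_one, Real.norm_eq_abs,
    sq_abs] at parallelogram
  linarith

-- The centre is placed so that both spheres meet the hyperplane
-- `inner ℝ p (z - a) = s` in the same sphere.
theorem mem_closedBall_sub_smul_of_real_inner_le (hr : r ≤ R) (hp : ‖p‖ = 1)
    (hz : z ∈ closedBall a r) (hs : inner ℝ p (z - a) ≤ s) :
    z ∈ closedBall (a - (√(R ^ 2 - r ^ 2 + s ^ 2) - s) • p) R := by
  have hr₀ : 0 ≤ r := nonneg_of_mem_closedBall hz
  have hrR : r ^ 2 ≤ R ^ 2 := pow_le_pow_left₀ hr₀ hr 2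
  rw [mem_closedBall_iff_norm] at hz ⊢
  set l := √(R ^ 2 - r ^ 2 + s ^ 2) - s with hl
  have hl₀ : 0 ≤ l := sub_nonneg.2 (Real.le_sqrt_of_sq_le (by linarith))
  have hl_sq : l ^ 2 + 2 * l * s + r ^ 2 = R ^ 2 := by
    have := Real.sq_sqrt (show 0 ≤ R ^ 2 - r ^ 2 + s ^ 2 by nlinarith)
    rw [show √(R ^ 2 - r ^ 2 + s ^ 2) = l + s by rw [hl, sub_add_cancel]] at this
    linarith
  rw [← sq_le_sq₀ (norm_nonneg _) (hr₀.trans hr)]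
  calc ‖z - (a - l • p)‖ ^ 2 = ‖z - a‖ ^ 2 + 2 * l * inner ℝ p (z - a) + l ^ 2 := by
        rw [← sub_add, norm_add_sq_real, inner_smul_right, real_inner_comm, norm_smul, hp,
          mul_one, Real.norm_eq_abs, sq_abs]
        ring
    _ ≤ r ^ 2 + 2 * l * s + l ^ 2 := by gcongr
    _ = R ^ 2 := by linarith

theorem exists_norm_eq_one_real_inner_add_infDist_le [CompleteSpace E] {A : Set E}
    (hA : Convex ℝ A) (hne : A.Nonempty) (hx : 0 < infDist x A) :
    ∃ p : E, ‖p‖ = 1 ∧ ∀ z ∈ A, inner ℝ p z + infDist x A ≤ inner ℝ p x := by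
  obtain ⟨y, hy, hmin⟩ := exists_norm_eq_iInf_of_complete_convex hne.closure
    isClosed_closure.isComplete hA.closure x
  rw [norm_eq_iInf_iff_real_inner_le_zero hA.closure hy] at hmin
  have hdist : infDist x A ≤ ‖x - y‖ := by
    rw [← infDist_closure, ← dist_eq_norm]
    exact infDist_le_dist_of_mem hy
  have hpos : 0 < ‖x - y‖ := hx.trans_le hdist
  refine ⟨‖x - y‖⁻¹ • (x - y), ?_, fun z hz => ?_⟩
  · rw [norm_smul, norm_inv, norm_norm, inv_mul_cancel₀ hpos.ne']
  have hzy : inner ℝ (‖x - y‖⁻¹ • (x - y)) (z - y) ≤ 0 := by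
    rw [real_inner_smul_left]
    exact mul_nonpos_of_nonneg_of_nonpos (by positivity) (hmin z (subset_closure hz))
  have hxy : inner ℝ (‖x - y‖⁻¹ • (x - y)) (x - y) = ‖x - y‖ := by
    rw [real_inner_smul_left, real_inner_self_eq_norm_sq]
    field
  rw [inner_sub_right] at hzy hxy
  linarith

theorem exists_norm_eq_one_real_inner_eq (he : ‖e‖ = 1) (he' : ‖e'‖ = 1)
    (hee' : inner ℝ e e' = 0) (hk₀ : -1 ≤ k) (hk₁ : k ≤ 1) :
    ∃ p : E, ‖p‖ = 1 ∧ inner ℝ e p = k := by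
  refine ⟨k • e + √(1 - k ^ 2) • e', ?_, ?_⟩
  · have hk : 0 ≤ 1 - k ^ 2 := sub_nonneg.2 ((sq_le_one_iff_abs_le_one k).2 (abs_le.2 ⟨hk₀, hk₁⟩))
    refine (pow_eq_one_iff_of_nonneg (norm_nonneg _) two_ne_zero).1 ?_
    rw [norm_add_sq_real, real_inner_smul_left, real_inner_smul_right, hee', norm_smul, norm_smul,
      he, he', mul_one, mul_one, Real.norm_eq_abs, Real.norm_eq_abs, sq_abs, sq_abs,
      Real.sq_sqrt hk]
    ring
  · rw [inner_add_right, real_inner_smul_right, real_inner_smul_right, hee',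
      real_inner_self_eq_norm_sq, he]
    ring

theorem exists_norm_smul_sub_smul_eq_sub (he : ‖e‖ = 1) (he' : ‖e'‖ = 1)
    (hee' : inner ℝ e e' = 0) (hρ : 0 < ρ) (hs : ρ ≤ s) (hsR : s ≤ R) :
    ∃ p : E, ‖p‖ = 1 ∧ ‖s • e - R • p‖ = R - ρ := by
  have hs₀ : 0 < s := hρ.trans_le hs
  have hR₀ : 0 < R := hs₀.trans_le hsR
  -- Squaring `‖s • e - R • p‖ = R - ρ` determines `inner ℝ e p`.
  obtain ⟨p, hp, hep⟩ := exists_norm_eq_one_real_inner_eq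
    (k := (s ^ 2 - ρ ^ 2 + 2 * R * ρ) / (2 * R * s)) he he' hee'
    (by
      have : 0 ≤ s ^ 2 - ρ ^ 2 := sub_nonneg.2 (by gcongr)
      exact neg_one_lt_zero.le.trans (by positivity))
    (by
      rw [div_le_one (by positivity)]
      nlinarith [mul_nonneg (sub_nonneg.2 hs) (by linarith : 0 ≤ 2 * R - s - ρ)])
  refine ⟨p, hp, ?_⟩
  rw [← sq_eq_sq₀ (norm_nonneg _) (by linarith), norm_sub_sq_real, real_inner_smul_left,
    real_inner_smul_right, hep, norm_smul, norm_smul, he, hp, mul_one, mul_one,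
    Real.norm_eq_abs, Real.norm_eq_abs, sq_abs, sq_abs]
  field

theorem mul_norm_smul_sub_sq_of_norm_sub_smul_eq_sub (hp : ‖p‖ = 1) (hv : ‖v - R • p‖ = R - ρ) :
    R * ‖ρ • p - v‖ ^ 2 = (R - ρ) * (‖v‖ ^ 2 - ρ ^ 2) := by
  have hv_sq : ‖v - R • p‖ ^ 2 = (R - ρ) ^ 2 := by rw [hv]
  rw [norm_sub_sq_real, real_inner_smul_right, norm_smul, hp, mul_one, Real.norm_eq_abs,
    sq_abs] at hv_sq
  rw [norm_sub_sq_real, real_inner_smul_left, real_inner_comm, norm_smul, hp, mul_one,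
    Real.norm_eq_abs, sq_abs]
  linear_combination ρ * hv_sq

end Euclidean

theorem sub_sqrt_sq_sub_sq_le_sq_div {r R : ℝ} (hr : |r| ≤ R) (hR : 0 < R) :
    R - √(R ^ 2 - r ^ 2) ≤ r ^ 2 / R := by
  have hsq : r ^ 2 ≤ R ^ 2 := sq_le_sq' (neg_le_of_abs_le hr) (le_of_abs_le hr)
  have hdiv : (r ^ 2 / R) ^ 2 ≤ r ^ 2 := by
    rw [div_pow, div_le_iff₀ (by positivity), sq (r ^ 2)]
    gcongr
  rw [sub_le_comm]
  refine Real.le_sqrt_of_sq_le ?_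
  calc (R - r ^ 2 / R) ^ 2 = R ^ 2 - 2 * r ^ 2 + (r ^ 2 / R) ^ 2 := by field
    _ ≤ R ^ 2 - r ^ 2 := by linarith

theorem le_sqrt_add_mul_max_sqrt {a b h u : ℝ} (ha : 0 ≤ a) (hb : 0 ≤ b) (hh : 0 ≤ h)
    (hu : u ^ 2 ≤ a * h + b * h ^ 2) : u ≤ √(a + b) * max √h h := by
  have hmax : h ≤ max √h h ^ 2 := by
    calc h = √h ^ 2 := (Real.sq_sqrt hh).symm
      _ ≤ max √h h ^ 2 := by gcongr; exact le_max_left _ _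
  rw [← Real.sqrt_sq (hh.trans (le_max_right √h h)), ← Real.sqrt_mul (add_nonneg ha hb)]
  refine Real.le_sqrt_of_sq_le (hu.trans ?_)
  calc a * h + b * h ^ 2 ≤ a * max √h h ^ 2 + b * max √h h ^ 2 := by
        gcongr
        exact le_max_right _ _
    _ = (a + b) * max √h h ^ 2 := by ring

theorem exists_mul_rpow_lt_mul_sqrt {α : ℝ} (hα : 1 / 2 < α) (C : ℝ) {c δ : ℝ} (hc : 0 < c)
    (hδ : 0 < δ) : ∃ u, 0 < u ∧ u < δ ∧ C * u ^ α < c * √u := by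
  have hα' : 0 < α - 1 / 2 := sub_pos.2 hα
  have hlim : Filter.Tendsto (fun u : ℝ => C * u ^ (α - 1 / 2)) (nhdsWithin 0 (Set.Ioi 0))
      (nhds 0) := by
    refine (Continuous.tendsto' ?_ 0 0 ?_).mono_left nhdsWithin_le_nhds
    · exact continuous_const.mul (Real.continuous_rpow_const hα'.le)
    · rw [Real.zero_rpow hα'.ne', mul_zero]
  obtain ⟨u, hu, hu₀, huδ⟩ := ((hlim.eventually_lt_const hc).and (Ioo_mem_nhdsGT hδ)).exists
  refine ⟨u, hu₀, huδ, ?_⟩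
  calc C * u ^ α = C * u ^ (α - 1 / 2) * √u := by
        rw [mul_assoc, Real.sqrt_eq_rpow, ← Real.rpow_add hu₀, sub_add_cancel]
    _ < c * √u := mul_lt_mul_of_pos_right hu (Real.sqrt_pos.2 hu₀)

theorem closedBall_inter_closedBall_subset_closedBall_add_smul_sub {E : Type*}
    [SeminormedAddCommGroup E] [NormedSpace ℝ E] {a c : E} {r R t : ℝ} (ht₀ : 0 ≤ t)
    (ht₁ : t ≤ 1) :
    closedBall c R ∩ closedBall a r ⊆ closedBall (c + t • (a - c)) ((1 - t) * R + t * r) := by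
  rintro x ⟨hxc, hxa⟩
  have hxc : dist c x ≤ R := mem_closedBall'.1 hxc
  have hxa : dist a x ≤ r := mem_closedBall'.1 hxa
  have ht : 0 ≤ 1 - t := sub_nonneg.2 ht₁
  rw [mem_closedBall', show c + t • (a - c) = (1 - t) • c + t • a by module]
  calc dist ((1 - t) • c + t • a) x ≤ (1 - t) * dist c x + t * dist a x :=
        (convexOn_univ_dist x).2 trivial trivial ht ht₀ (by ring)
    _ ≤ (1 - t) * R + t * r := by gcongr

theorem subset_cthickening_hausdorffDist {X : Type*} [PseudoMetricSpace X] {A B : Set X}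
    (h : hausdorffEDist A B ≠ ⊤) : A ⊆ cthickening (hausdorffDist A B) B := fun x hx => by
  rw [mem_cthickening_iff, hausdorffDist, ENNReal.ofReal_toReal h]
  exact infEDist_le_hausdorffEDist_of_mem hx

section StronglyConvexHull

variable {n : ℕ} {R : ℝ} {A B : Set (EuclideanSpace ℝ (Fin n))}
  {a b c p x y : EuclideanSpace ℝ (Fin n)}

theorem stronglyConvexHull_eq_iInter :
    stronglyConvexHull R A = ⋂ (c) (_ : A ⊆ closedBall c R), closedBall c R := by
  ext x
  simp only [stronglyConvexHull, Set.mem_ofPred_eq, Set.mem_iInter]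

theorem subset_stronglyConvexHull : A ⊆ stronglyConvexHull R A :=
  fun _ hx _ hc => hc hx

theorem stronglyConvexHull_subset_closedBall (hc : A ⊆ closedBall c R) :
    stronglyConvexHull R A ⊆ closedBall c R :=
  fun _ hx => hx c hc

theorem convex_stronglyConvexHull : Convex ℝ (stronglyConvexHull R A) := by
  rw [stronglyConvexHull_eq_iInter]
  exact convex_iInter₂ fun c _ => convex_closedBall c R

theorem isClosed_stronglyConvexHull : IsClosed (stronglyConvexHull R A) := by
  rw [stronglyConvexHull_eq_iInter]
  exact isClosed_biInter fun _ _ => isClosed_closedBall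

theorem isCompact_stronglyConvexHull (ha : A ⊆ closedBall a R) :
    IsCompact (stronglyConvexHull R A) :=
  (isCompact_closedBall a R).of_isClosed_subset isClosed_stronglyConvexHull
    (stronglyConvexHull_subset_closedBall ha)

theorem infDist_le_of_mem_stronglyConvexHull {r : ℝ} (hconv : Convex ℝ A) (hne : A.Nonempty)
    (ha : A ⊆ closedBall a r) (hr : r ≤ R) (hx : x ∈ stronglyConvexHull R A) :
    infDist x A ≤ R - √(R ^ 2 - r ^ 2) := by
  rcases (infDist_nonneg (s := A) (x := x)).eq_or_lt with hzero | hpos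
  · rw [← hzero, sub_nonneg]
    have hr₀ : 0 ≤ r := nonempty_closedBall.1 (hne.mono ha)
    exact Real.sqrt_le_iff.2 ⟨hr₀.trans hr, sub_le_self _ (sq_nonneg r)⟩
  obtain ⟨p, hp, hsep⟩ := exists_norm_eq_one_real_inner_add_infDist_le hconv hne hpos
  set s := inner ℝ p (x - a) - infDist x A with hs
  have hA : A ⊆ closedBall (a - (√(R ^ 2 - r ^ 2 + s ^ 2) - s) • p) R := fun z hz => by
    refine mem_closedBall_sub_smul_of_real_inner_le hr hp (ha hz) ?_
    rw [hs, inner_sub_right, inner_sub_right]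
    linarith [hsep z hz]
  have hsupp := real_inner_le_add_of_mem_closedBall hp (hx _ hA)
  rw [inner_sub_right, inner_smul_right, real_inner_self_eq_norm_sq, hp] at hsupp
  rw [inner_sub_right] at hs
  calc infDist x A ≤ R - √(R ^ 2 - r ^ 2 + s ^ 2) := by linarith
    _ ≤ R - √(R ^ 2 - r ^ 2) := by
        gcongr
        exact le_add_of_nonneg_right (sq_nonneg s)

theorem hausdorffDist_stronglyConvexHull_le {r : ℝ} (hconv : Convex ℝ A) (hne : A.Nonempty)
    (ha : A ⊆ closedBall a r) (hr : r ≤ R) :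
    hausdorffDist A (stronglyConvexHull R A) ≤ R - √(R ^ 2 - r ^ 2) := by
  have hinf : ∀ x ∈ stronglyConvexHull R A, infDist x A ≤ R - √(R ^ 2 - r ^ 2) := fun _ =>
    infDist_le_of_mem_stronglyConvexHull hconv hne ha hr
  have hnonneg : 0 ≤ R - √(R ^ 2 - r ^ 2) :=
    infDist_nonneg.trans (hinf _ (subset_stronglyConvexHull hne.some_mem))
  refine hausdorffDist_le_of_infDist hnonneg (fun x hx => ?_) hinf
  rwa [infDist_zero_of_mem (subset_stronglyConvexHull hx)]

theorem mem_argmaxSet_of_subset_closedBall (hp : ‖p‖ = 1) (hx : x ∈ A)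
    (hA : A ⊆ closedBall (x - R • p) R) : x ∈ argmaxSet p A := by
  refine ⟨hx, fun y hy => ?_⟩
  have hle := real_inner_le_add_of_mem_closedBall hp (hA hy)
  rwa [inner_sub_right, inner_smul_right, real_inner_self_eq_norm_sq, hp, one_pow, mul_one,
    sub_add_cancel] at hle

-- The hull contains the point at `t` on the segment from `x` to `z` pushed by
-- `t (1 - t) ‖z - x‖² / (2 R)` along `p`. Compare with the maximum at `x`, divide by `t` and let
-- `t → 0`.
theorem stronglyConvexHull_subset_closedBall_of_mem_argmaxSet (hR : 0 < R) (hp : ‖p‖ = 1)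
    (hx : x ∈ argmaxSet p (stronglyConvexHull R A)) :
    stronglyConvexHull R A ⊆ closedBall (x - R • p) R := by
  intro z hz
  set m := ‖z - x‖ ^ 2 / (2 * R) with hm
  have hmax : ∀ t : ℝ, 0 < t → t ≤ 1 → inner ℝ p (z - x) + (1 - t) * m ≤ 0 := by
    intro t ht₀ ht₁
    have hle := hx.2 _ fun c hc =>
      add_smul_sub_add_smul_mem_closedBall hR (hx.1 c hc) (hz c hc) hp.le ht₀.le ht₁
    rw [inner_add_right, inner_add_right, inner_smul_right, inner_smul_right,
      real_inner_self_eq_norm_sq, hp, mul_div_assoc, ← hm] at hle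
    refine nonpos_of_mul_nonpos_right (a := t) ?_ ht₀
    linarith
  have hlim : inner ℝ p (z - x) + m ≤ 0 := by
    have hcont : Continuous fun t : ℝ => inner ℝ p (z - x) + (1 - t) * m := by fun_prop
    have htendsto := (hcont.tendsto' 0 (inner ℝ p (z - x) + m) (by ring)).mono_left
      (nhdsWithin_le_nhds (s := Set.Ioi (0 : ℝ)))
    refine le_of_tendsto htendsto ?_
    filter_upwards [Ioc_mem_nhdsGT (zero_lt_one' ℝ)] with t ht using hmax t ht.1 ht.2
  rw [mem_closedBall_iff_norm, ← sq_le_sq₀ (norm_nonneg _) hR.le]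
  calc ‖z - (x - R • p)‖ ^ 2 = R ^ 2 + 2 * R * (inner ℝ p (z - x) + m) := by
        rw [← sub_add, norm_add_sq_real, inner_smul_right, real_inner_comm, norm_smul, hp,
          mul_one, Real.norm_eq_abs, sq_abs, hm]
        field
    _ ≤ R ^ 2 := add_le_of_nonpos_right (mul_nonpos_of_nonneg_of_nonpos (by positivity) hlim)

theorem exists_argmaxSet_stronglyConvexHull_eq_singleton (hR : 0 < R) (hne : A.Nonempty)
    (ha : A ⊆ closedBall a R) (hp : ‖p‖ = 1) :
    ∃ x, argmaxSet p (stronglyConvexHull R A) = {x} := by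
  obtain ⟨x, hx, hmax⟩ := (isCompact_stronglyConvexHull ha).exists_isMaxOn
    (hne.mono subset_stronglyConvexHull)
    (f := fun y => (inner ℝ p y : ℝ)) (by fun_prop)
  have hx : x ∈ argmaxSet p (stronglyConvexHull R A) := ⟨hx, fun y hy => hmax hy⟩
  refine ⟨x, Set.eq_singleton_iff_unique_mem.2 ⟨hx, fun y hy => ?_⟩⟩
  have hsupp := @stronglyConvexHull_subset_closedBall_of_mem_argmaxSet n R A p
  have hsq : ‖y - x‖ ^ 2 ≤ 0 := by
    simpa using norm_sub_sq_le_of_mem_closedBall_sub_smul (R := R) (k := 0) hp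
      (by simpa using hsupp hR hp hx hy.1) (by simpa using hsupp hR hp hy hx.1)
  exact sub_eq_zero.1 (norm_eq_zero.1 (sq_eq_zero_iff.1 (hsq.antisymm (sq_nonneg _))))

-- Moving the centre from `c` towards `a` by the fraction `t` shrinks the radius of a ball
-- around `A` by `t * (R - r)`, exactly the room that `B` needs.
theorem stronglyConvexHull_subset_closedBall_add_mul_dist {r t : ℝ} (ht₀ : 0 ≤ t) (ht₁ : t ≤ 1)
    (hr₀ : 0 ≤ r) (hr : r ≤ R) (ha : A ⊆ closedBall a r) (hc : A ⊆ closedBall c R)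
    (hBA : B ⊆ cthickening (t * (R - r)) A) :
    stronglyConvexHull R B ⊆ closedBall c (R + t * dist a c) := by
  have : 0 ≤ 1 - t := sub_nonneg.2 ht₁
  have hR : 0 ≤ R := hr₀.trans hr
  have hA : A ⊆ closedBall (c + t • (a - c)) ((1 - t) * R + t * r) :=
    (Set.subset_inter hc ha).trans
      (closedBall_inter_closedBall_subset_closedBall_add_smul_sub ht₀ ht₁)
  have hB : B ⊆ closedBall (c + t • (a - c)) R := by
    convert! hBA.trans (cthickening_subset_of_subset _ hA) using 1
    rw [cthickening_closedBall (mul_nonneg ht₀ (sub_nonneg.2 hr)) (by positivity)]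
    congr 1
    ring
  refine (stronglyConvexHull_subset_closedBall hB).trans (closedBall_subset_closedBall' ?_)
  rw [dist_eq_norm, add_sub_cancel_left, norm_smul, Real.norm_of_nonneg ht₀, ← dist_eq_norm]

theorem stronglyConvexHull_subset_closedBall_add_of_subset_cthickening {r h : ℝ} (hr : r < R)
    (hh : 0 ≤ h) (hB : B.Nonempty) (ha : A ⊆ closedBall a r) (hb : B ⊆ closedBall b r)
    (hBA : B ⊆ cthickening h A) (hc : A ⊆ closedBall c R) :
    stronglyConvexHull R B ⊆ closedBall c (R + 2 * R / (R - r) * h) := by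
  have hRr : 0 < R - r := sub_pos.2 hr
  have hr₀ : 0 ≤ r := nonempty_closedBall.1 (hB.mono hb)
  have hR₀ : 0 ≤ R := hr₀.trans hr.le
  rcases le_total h (R - r) with hle | hge
  · have hA : A.Nonempty := by
      rw [Set.nonempty_iff_ne_empty]
      rintro rfl
      rw [cthickening_empty] at hBA
      exact hB.ne_empty (Set.subset_empty_iff.1 hBA)
    obtain ⟨z, hz⟩ := hA
    have hac : dist a c ≤ 2 * R := by
      linarith [dist_triangle_left a c z, mem_closedBall.1 (ha hz), mem_closedBall.1 (hc hz)]
    refine (stronglyConvexHull_subset_closedBall_add_mul_dist (t := h / (R - r)) (by positivity)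
      ((div_le_one hRr).2 hle) hr₀ hr.le ha hc (by rwa [div_mul_cancel₀ _ hRr.ne'])).trans
      (closedBall_subset_closedBall ?_)
    calc R + h / (R - r) * dist a c ≤ R + h / (R - r) * (2 * R) := by gcongr
      _ = R + 2 * R / (R - r) * h := by ring
  · obtain ⟨y, hy⟩ := hB
    have hyc : y ∈ closedBall c (h + R) := by
      rw [← cthickening_closedBall hh hR₀]
      exact cthickening_subset_of_subset h hc (hBA hy)
    refine (stronglyConvexHull_subset_closedBall
      (hb.trans (closedBall_subset_closedBall hr.le))).trans (closedBall_subset_closedBall' ?_)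
    calc R + dist b c ≤ R + (r + (h + R)) := by
          linarith [dist_triangle_left b c y, mem_closedBall.1 (hb hy), mem_closedBall.1 hyc]
      _ = R + ((R + r) / (R - r) * (R - r) + h) := by field
      _ ≤ R + ((R + r) / (R - r) * h + h) := by gcongr
      _ = R + 2 * R / (R - r) * h := by field

theorem norm_sub_sq_le_of_mem_argmaxSet_stronglyConvexHull {r : ℝ} (hr : r < R)
    (hA : A.Nonempty) (hB : B.Nonempty) (ha : A ⊆ closedBall a r) (hb : B ⊆ closedBall b r)
    (hp : ‖p‖ = 1) (hx : x ∈ argmaxSet p (stronglyConvexHull R A))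
    (hy : y ∈ argmaxSet p (stronglyConvexHull R B)) :
    ‖x - y‖ ^ 2 ≤ 2 * R * (2 * R / (R - r) * hausdorffDist A B) +
      (2 * R / (R - r) * hausdorffDist A B) ^ 2 := by
  have hR : 0 < R := (nonempty_closedBall.1 (hA.mono ha)).trans_lt hr
  have hfin : hausdorffEDist A B ≠ ⊤ := hausdorffEDist_ne_top_of_nonempty_of_bounded hA hB
    (isBounded_closedBall.subset ha) (isBounded_closedBall.subset hb)
  have hAB : A ⊆ cthickening (hausdorffDist A B) B := subset_cthickening_hausdorffDist hfin
  have hBA : B ⊆ cthickening (hausdorffDist A B) A := by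
    rw [hausdorffDist_comm]
    exact subset_cthickening_hausdorffDist (by rwa [hausdorffEDist_comm])
  have hsuppA : A ⊆ closedBall (x - R • p) R := subset_stronglyConvexHull.trans
    (stronglyConvexHull_subset_closedBall_of_mem_argmaxSet hR hp hx)
  have hsuppB : B ⊆ closedBall (y - R • p) R := subset_stronglyConvexHull.trans
    (stronglyConvexHull_subset_closedBall_of_mem_argmaxSet hR hp hy)
  exact norm_sub_sq_le_of_mem_closedBall_sub_smul hp
    (stronglyConvexHull_subset_closedBall_add_of_subset_cthickening hr hausdorffDist_nonneg hA hb
      ha hAB hsuppB hx.1)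
    (stronglyConvexHull_subset_closedBall_add_of_subset_cthickening hr hausdorffDist_nonneg hB ha
      hb hBA hsuppA hy.1)

theorem norm_sub_le_of_mem_argmaxSet_stronglyConvexHull {r : ℝ} (hr : r < R)
    (hA : A.Nonempty) (hB : B.Nonempty) (ha : A ⊆ closedBall a r) (hb : B ⊆ closedBall b r)
    (hp : ‖p‖ = 1) (hx : x ∈ argmaxSet p (stronglyConvexHull R A))
    (hy : y ∈ argmaxSet p (stronglyConvexHull R B)) :
    ‖x - y‖ ≤ √(2 * R * (2 * R / (R - r)) + (2 * R / (R - r)) ^ 2) *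
      max √(hausdorffDist A B) (hausdorffDist A B) := by
  have hR : 0 ≤ R := (nonempty_closedBall.1 (hA.mono ha)).trans hr.le
  have hk : 0 ≤ 2 * R / (R - r) := div_nonneg (by positivity) (sub_nonneg.2 hr.le)
  refine le_sqrt_add_mul_max_sqrt (mul_nonneg (by positivity) hk) (sq_nonneg _)
    hausdorffDist_nonneg ?_
  linarith [norm_sub_sq_le_of_mem_argmaxSet_stronglyConvexHull hr hA hB ha hb hp hx hy]

end StronglyConvexHull

section Sharpness

variable {n : ℕ} {R ρ : ℝ} {p v w : EuclideanSpace ℝ (Fin n)}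

/-- The cap body with apex `v`: the closed convex hull of the ball of radius `ρ` about the origin
and the point `v`, whose support points move with exponent `1 / 2` as `v` leaves the ball. The
plain hull is already closed; the closed hull makes compactness immediate. -/
def capBody (ρ : ℝ) (v : EuclideanSpace ℝ (Fin n)) : Set (EuclideanSpace ℝ (Fin n)) :=
  closedConvexHull ℝ (insert v (closedBall 0 ρ))

theorem apex_mem_capBody : v ∈ capBody ρ v :=
  subset_closedConvexHull (Set.mem_insert v _)

theorem closedBall_subset_capBody : closedBall 0 ρ ⊆ capBody ρ v :=
  (Set.subset_insert v _).trans subset_closedConvexHull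

theorem convex_capBody : Convex ℝ (capBody ρ v) :=
  convex_closedConvexHull

theorem capBody_subset {K : Set (EuclideanSpace ℝ (Fin n))} (hK : Convex ℝ K)
    (hK' : IsClosed K) (hv : v ∈ K) (hρ : closedBall 0 ρ ⊆ K) : capBody ρ v ⊆ K :=
  closedConvexHull_min (Set.insert_subset hv hρ) hK hK'

theorem capBody_subset_closedBall {c : EuclideanSpace ℝ (Fin n)} (hv : v ∈ closedBall c R)
    (hρ : closedBall 0 ρ ⊆ closedBall c R) : capBody ρ v ⊆ closedBall c R :=
  capBody_subset (convex_closedBall c R) isClosed_closedBall hv hρ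

theorem isCompact_capBody : IsCompact (capBody ρ v) := by
  refine isCompact_of_isClosed_isBounded isClosed_closedConvexHull
    (isBounded_closedBall.subset (capBody_subset_closedBall (c := 0) (R := max ‖v‖ ρ) ?_ ?_))
  · exact mem_closedBall_zero_iff.2 (le_max_left _ _)
  · exact closedBall_subset_closedBall (le_max_right _ _)

theorem capBody_subset_capBody_add_closedBall {η : ℝ} (h : dist v w ≤ η) :
    capBody ρ v ⊆ capBody ρ w + closedBall 0 η := by
  refine capBody_subset (convex_capBody.add (convex_closedBall 0 η))
    (isCompact_capBody.add (isCompact_closedBall 0 η)).isClosed ?_ ?_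
  · exact ⟨w, apex_mem_capBody, v - w, mem_closedBall_zero_iff.2 (dist_eq_norm v w ▸ h),
      add_sub_cancel w v⟩
  · exact closedBall_subset_capBody.trans
      (Set.subset_add_left _ (mem_closedBall_self (dist_nonneg.trans h)))

theorem hausdorffDist_capBody_le : hausdorffDist (capBody ρ v) (capBody ρ w) ≤ dist v w := by
  have hclose : ∀ v w : EuclideanSpace ℝ (Fin n), ∀ x ∈ capBody ρ v,
      ∃ y ∈ capBody ρ w, dist x y ≤ dist v w := by
    intro v w x hx
    obtain ⟨y, hy, z, hz, rfl⟩ := capBody_subset_capBody_add_closedBall le_rfl hx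
    exact ⟨y, hy, by simpa only [dist_self_add_left] using mem_closedBall_zero_iff.1 hz⟩
  exact hausdorffDist_le_of_mem_dist dist_nonneg (hclose v w) (dist_comm v w ▸ hclose w v)

theorem isAdmissible_capBody {r d : ℝ} (hn : n ≠ 0) (hρ : 0 ≤ ρ) (hρr : ρ ≤ r)
    (hd : d ≤ 2 * ρ) :
    IsAdmissible r d fun v : closedBall (0 : EuclideanSpace ℝ (Fin n)) r => capBody ρ v.1 where
  continuous v := by
    refine ⟨fun η hη => ⟨η, hη, fun w hw => ?_⟩, fun η hη => ⟨η, hη, fun w hw => ?_⟩⟩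
    · exact capBody_subset_capBody_add_closedBall hw.le
    · exact capBody_subset_capBody_add_closedBall (dist_comm v w ▸ hw.le)
  nonempty v := ⟨v, apex_mem_capBody⟩
  compact v := isCompact_capBody
  convex v := convex_capBody
  subset_ball v := ⟨0, capBody_subset_closedBall v.2 (closedBall_subset_closedBall hρr)⟩
  le_diam v := by
    have : Nonempty (Fin n) := Fin.pos_iff_nonempty.1 (Nat.pos_of_ne_zero hn)
    calc d ≤ 2 * ρ := hd
      _ = diam (closedBall (0 : EuclideanSpace ℝ (Fin n)) ρ) := (diam_closedBall_eq 0 hρ).symm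
      _ ≤ diam (capBody ρ v.1) := diam_mono closedBall_subset_capBody isCompact_capBody.isBounded

theorem smul_mem_argmaxSet_stronglyConvexHull_capBody (hρ : 0 ≤ ρ) (hρR : ρ ≤ R) (hp : ‖p‖ = 1)
    (hv : ‖v‖ ≤ ρ) : ρ • p ∈ argmaxSet p (stronglyConvexHull R (capBody ρ v)) := by
  have hpρ : ρ • p ∈ closedBall (0 : EuclideanSpace ℝ (Fin n)) ρ := by
    rw [mem_closedBall_zero_iff, norm_smul, hp, mul_one, Real.norm_of_nonneg hρ]
  have hball : closedBall (0 : EuclideanSpace ℝ (Fin n)) ρ ⊆ closedBall (ρ • p - R • p) R := by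
    refine closedBall_subset_closedBall' ?_
    rw [dist_zero_left, ← sub_smul, norm_smul, hp, mul_one, Real.norm_eq_abs, abs_sub_comm,
      abs_of_nonneg (sub_nonneg.2 hρR), add_sub_cancel]
  refine mem_argmaxSet_of_subset_closedBall hp
    (subset_stronglyConvexHull (closedBall_subset_capBody hpρ))
    (stronglyConvexHull_subset_closedBall (capBody_subset_closedBall (hball ?_) hball))
  exact mem_closedBall_zero_iff.2 hv

theorem apex_mem_argmaxSet_stronglyConvexHull_capBody (hR : 0 ≤ R) (hp : ‖p‖ = 1)
    (hv : ‖v - R • p‖ ≤ R - ρ) : v ∈ argmaxSet p (stronglyConvexHull R (capBody ρ v)) := by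
  refine mem_argmaxSet_of_subset_closedBall hp (subset_stronglyConvexHull apex_mem_capBody)
    (stronglyConvexHull_subset_closedBall (capBody_subset_closedBall ?_ ?_))
  · rw [mem_closedBall_iff_norm, sub_sub_cancel, norm_smul, hp, mul_one, Real.norm_of_nonneg hR]
  · refine closedBall_subset_closedBall' ?_
    rw [dist_zero_left]
    linarith

theorem exists_argmaxSet_capBody {e e' : EuclideanSpace ℝ (Fin n)} {s : ℝ} (he : ‖e‖ = 1)
    (he' : ‖e'‖ = 1) (hee' : inner ℝ e e' = 0) (hρ : 0 < ρ) (hs : ρ ≤ s) (hsR : s ≤ R) :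
    ∃ p x y : EuclideanSpace ℝ (Fin n), ‖p‖ = 1 ∧
      x ∈ argmaxSet p (stronglyConvexHull R (capBody ρ (ρ • e))) ∧
      y ∈ argmaxSet p (stronglyConvexHull R (capBody ρ (s • e))) ∧
      √(2 * ρ * (R - ρ) / R) * √(s - ρ) ≤ ‖x - y‖ := by
  have hR : 0 < R := hρ.trans_le (hs.trans hsR)
  have norm_smul_e : ∀ t : ℝ, 0 ≤ t → ‖t • e‖ = t := fun t ht => by
    rw [norm_smul, he, mul_one, Real.norm_of_nonneg ht]
  obtain ⟨p, hp, htangent⟩ := exists_norm_smul_sub_smul_eq_sub he he' hee' hρ hs hsR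
  refine ⟨p, ρ • p, s • e, hp,
    smul_mem_argmaxSet_stronglyConvexHull_capBody hρ.le (hs.trans hsR) hp
      (norm_smul_e ρ hρ.le).le,
    apex_mem_argmaxSet_stronglyConvexHull_capBody hR.le hp htangent.le, ?_⟩
  have hnorm := mul_norm_smul_sub_sq_of_norm_sub_smul_eq_sub hp htangent
  rw [norm_smul_e s (hρ.le.trans hs)] at hnorm
  rw [← Real.sqrt_mul (div_nonneg (mul_nonneg (by positivity) (by linarith)) hR.le)]
  refine Real.sqrt_le_iff.2 ⟨norm_nonneg _, ?_⟩
  rw [div_mul_eq_mul_div, div_le_iff₀' hR, hnorm]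
  calc 2 * ρ * (R - ρ) * (s - ρ) = (R - ρ) * ((s - ρ) * (ρ + ρ)) := by ring
    _ ≤ (R - ρ) * ((s - ρ) * (s + ρ)) := by
        have := sub_nonneg.2 hs
        have := sub_nonneg.2 (hs.trans hsR)
        gcongr
    _ = (R - ρ) * (s ^ 2 - ρ ^ 2) := by ring

theorem exists_isAdmissible_mul_rpow_hausdorffDist_lt {r d : ℝ} (hn : 2 ≤ n) (hr : 0 < r)
    (hrR : r ≤ R) (hd : d < 2 * r) :
    ∃ (T : Type) (_ : MetricSpace T) (F : T → Set (EuclideanSpace ℝ (Fin n))),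
      IsAdmissible r d F ∧
      ∀ α : ℝ, 1 / 2 < α → ∀ C δ : ℝ, 0 < δ →
        ∃ (t₁ t₂ : T) (p x₁ x₂ : EuclideanSpace ℝ (Fin n)), ‖p‖ = 1 ∧
          x₁ ∈ argmaxSet p (stronglyConvexHull R (F t₁)) ∧
          x₂ ∈ argmaxSet p (stronglyConvexHull R (F t₂)) ∧
          hausdorffDist (F t₁) (F t₂) < δ ∧
          C * hausdorffDist (F t₁) (F t₂) ^ α < ‖x₁ - x₂‖ := by
  obtain ⟨e, e', he, he', hee'⟩ : ∃ e e' : EuclideanSpace ℝ (Fin n),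
      ‖e‖ = 1 ∧ ‖e'‖ = 1 ∧ inner ℝ e e' = 0 := by
    have ho := EuclideanSpace.orthonormal_single (𝕜 := ℝ) (ι := Fin n)
    exact ⟨_, _, ho.1 ⟨0, by omega⟩, ho.1 ⟨1, by omega⟩, ho.2 (by simp)⟩
  obtain ⟨ρ, hρ, hρr⟩ : ∃ ρ, max 0 (d / 2) < ρ ∧ ρ < r := exists_between (max_lt hr (by linarith))
  obtain ⟨hρ₀, hdρ⟩ := max_lt_iff.1 hρ
  refine ⟨closedBall (0 : EuclideanSpace ℝ (Fin n)) r, inferInstance, fun v => capBody ρ v,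
    isAdmissible_capBody (by omega) hρ₀.le hρr.le (by linarith), fun α hα C δ hδ => ?_⟩
  have hc : 0 < 2 * ρ * (R - ρ) / R :=
    div_pos (mul_pos (by positivity) (by linarith)) (hr.trans_le hrR)
  obtain ⟨u, hu₀, hu, hCu⟩ := exists_mul_rpow_lt_mul_sqrt hα |C| (Real.sqrt_pos.2 hc)
    (lt_min hδ (sub_pos.2 hρr))
  obtain ⟨huδ, hur⟩ := lt_min_iff.1 hu
  have hmem : ∀ t : ℝ, 0 ≤ t → t ≤ r → t • e ∈ closedBall (0 : EuclideanSpace ℝ (Fin n)) r :=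
    fun t ht₀ htr => by
      rwa [mem_closedBall_zero_iff, norm_smul, he, mul_one, Real.norm_of_nonneg ht₀]
  obtain ⟨p, x, y, hp, hx, hy, hxy⟩ := exists_argmaxSet_capBody (R := R) (s := ρ + u)
    he he' hee' hρ₀ (by linarith) (by linarith)
  rw [add_sub_cancel_left] at hxy
  have hdist : hausdorffDist (capBody ρ (ρ • e)) (capBody ρ ((ρ + u) • e)) ≤ u := by
    refine hausdorffDist_capBody_le.trans_eq ?_
    rw [dist_eq_norm', ← sub_smul, add_sub_cancel_left, norm_smul, he, mul_one,
      Real.norm_of_nonneg hu₀.le]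
  refine ⟨⟨ρ • e, hmem ρ hρ₀.le hρr.le⟩, ⟨(ρ + u) • e, hmem _ (by linarith) (by linarith)⟩, p, x, y,
    hp, hx, hy, hdist.trans_lt huδ, ?_⟩
  calc C * hausdorffDist (capBody ρ (ρ • e)) (capBody ρ ((ρ + u) • e)) ^ α ≤ |C| * u ^ α := by
        gcongr
        · exact Real.rpow_nonneg hausdorffDist_nonneg α
        · exact le_abs_self C
        · exact hausdorffDist_nonneg
    _ < √(2 * ρ * (R - ρ) / R) * √u := hCu
    _ ≤ ‖x - y‖ := hxy

end Sharpness

theorem theorem3_general (ε r : ℝ) (hε : 0 < ε) (hr : 0 < r) :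
    (∃ C : ℝ, ∀ (n : ℕ) (T : Type*) (F : T → Set (EuclideanSpace ℝ (Fin n))),
      (∀ t, (F t).Nonempty) → (∀ t, Convex ℝ (F t)) → (∀ t, ∃ a, F t ⊆ closedBall a r) →
        (∀ t, F t ⊆ strongApprox ε r F t ∧
          IsCompact (strongApprox ε r F t) ∧ Convex ℝ (strongApprox ε r F t) ∧
          hausdorffDist (F t) (strongApprox ε r F t) ≤ ε) ∧
        ∃ f : T → EuclideanSpace ℝ (Fin n) → EuclideanSpace ℝ (Fin n),
          (∀ t p, ‖p‖ = 1 → argmaxSet p (strongApprox ε r F t) = {f t p}) ∧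
          ∀ t₁ t₂ p, ‖p‖ = 1 →
            ‖f t₁ p - f t₂ p‖ ≤
              C * max √(hausdorffDist (F t₁) (F t₂)) (hausdorffDist (F t₁) (F t₂))) ∧
    (∀ (d : ℝ) (n : ℕ), 2 ≤ n → d < 2 * r →
      ∃ (T : Type) (_ : MetricSpace T) (F : T → Set (EuclideanSpace ℝ (Fin n))),
        IsAdmissible r d F ∧
        ∀ α : ℝ, 1 / 2 < α → ∀ C δ : ℝ, 0 < δ →
          ∃ (t₁ t₂ : T) (p x₁ x₂ : EuclideanSpace ℝ (Fin n)), ‖p‖ = 1 ∧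
            x₁ ∈ argmaxSet p (strongApprox ε r F t₁) ∧
            x₂ ∈ argmaxSet p (strongApprox ε r F t₂) ∧
            hausdorffDist (F t₁) (F t₂) < δ ∧
            C * hausdorffDist (F t₁) (F t₂) ^ α < ‖x₁ - x₂‖) := by
  unfold strongApprox
  set R := max (r ^ 2 / ε) (r + 1)
  have hrR : r < R := (lt_add_one r).trans_le (le_max_right _ _)
  have hR : 0 < R := hr.trans hrR
  have hsagitta : R - √(R ^ 2 - r ^ 2) ≤ ε :=
    (sub_sqrt_sq_sub_sq_le_sq_div ((abs_of_pos hr).trans_le hrR.le) hR).trans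
      ((div_le_comm₀ hε hR).1 (le_max_left _ _))
  refine ⟨⟨√(2 * R * (2 * R / (R - r)) + (2 * R / (R - r)) ^ 2),
    fun n T F hne hconv hball => ?_⟩, fun d n hn hd =>
      exists_isAdmissible_mul_rpow_hausdorffDist_lt hn hr hrR.le hd⟩
  choose a ha using hball
  have haR : ∀ t, F t ⊆ closedBall (a t) R := fun t =>
    (ha t).trans (closedBall_subset_closedBall hrR.le)
  choose! f hf using fun t p (hp : ‖p‖ = 1) =>
    exists_argmaxSet_stronglyConvexHull_eq_singleton hR (hne t) (haR t) hp
  have hmem : ∀ t p, ‖p‖ = 1 → f t p ∈ argmaxSet p (stronglyConvexHull R (F t)) :=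
    fun t p hp => hf t p hp ▸ Set.mem_singleton _
  exact ⟨fun t => ⟨subset_stronglyConvexHull, isCompact_stronglyConvexHull (haR t),
      convex_stronglyConvexHull, (hausdorffDist_stronglyConvexHull_le (hconv t) (hne t) (ha t)
        hrR.le).trans hsagitta⟩,
    f, hf, fun t₁ t₂ p hp => norm_sub_le_of_mem_argmaxSet_stronglyConvexHull hrR (hne t₁) (hne t₂)
      (ha t₁) (ha t₂) hp (hmem t₁ p hp) (hmem t₂ p hp)⟩

theorem theorem3 (ε r d : ℝ) (hε₀ : 0 < ε) (hε₁ : ε < 1) (hr : 0 < r) (hd : 0 < d) :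
    (∃ C : ℝ, ∀ (n : ℕ) (T : Type*) [MetricSpace T] (F : T → Set (EuclideanSpace ℝ (Fin n))),
      IsAdmissible r d F →
        (∀ t, F t ⊆ strongApprox ε r F t ∧
          IsCompact (strongApprox ε r F t) ∧ Convex ℝ (strongApprox ε r F t) ∧
          Metric.hausdorffDist (F t) (strongApprox ε r F t) ≤ ε) ∧
        ∃ f : T → EuclideanSpace ℝ (Fin n) → EuclideanSpace ℝ (Fin n),
          (∀ t p, ‖p‖ = 1 → argmaxSet p (strongApprox ε r F t) = {f t p}) ∧
          ∀ t₁ t₂ p, ‖p‖ = 1 →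
            ‖f t₁ p - f t₂ p‖ ≤
              C * max (Real.sqrt (Metric.hausdorffDist (F t₁) (F t₂)))
                (Metric.hausdorffDist (F t₁) (F t₂))) ∧
    (∀ n : ℕ, 2 ≤ n → d < 2 * r →
      ∃ (T : Type) (_ : MetricSpace T) (F : T → Set (EuclideanSpace ℝ (Fin n))),
        IsAdmissible r d F ∧
        ∀ α : ℝ, 1 / 2 < α → ∀ C δ : ℝ, 0 < δ →
          ∃ (t₁ t₂ : T) (p x₁ x₂ : EuclideanSpace ℝ (Fin n)), ‖p‖ = 1 ∧
            x₁ ∈ argmaxSet p (strongApprox ε r F t₁) ∧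
            x₂ ∈ argmaxSet p (strongApprox ε r F t₂) ∧
            Metric.hausdorffDist (F t₁) (F t₂) < δ ∧
            C * Metric.hausdorffDist (F t₁) (F t₂) ^ α < ‖x₁ - x₂‖) := by
  obtain ⟨⟨C, hC⟩, hsharp⟩ := theorem3_general ε r hε₀ hr
  exact ⟨⟨C, fun n T _ F hF => hC n T F hF.nonempty hF.convex hF.subset_ball⟩, hsharp d⟩
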